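/- Let $A$ be a finite (possibly nonabelian) group and let $A^{\mathbb N}$, $\mathbb N=\{0,1,2,\ldots\}$, carry the product $\sigma$-algebra. Let $\sigma:A^{\mathbb N}\to A^{\mathbb N}$ be the shift, $\sigma(a)_n=a_{n+1}$, and let $\Phi:A^{\mathbb N}\to A^{\mathbb N}$ be the nearest neighbour multiplication cellular automaton, $\Phi(a)_n=a_n\cdot a_{n+1}$. Put $$h_{\max}=\max\{\log_2|C| : C \text{ a proper subgroup of } A\}$$ (with $h_{\max}=0$ if $A$ is trivial, so that $h_{\max}=0$ whenever $A$ has no nontrivial proper subgroup). Let $\mu$ be a probability measure on $A^{\mathbb N}$ that is $\sigma$-invariant and $\Phi$-ergodic (that is, $\mu$ is $\Phi$-invariant and every measurable set $U$ with $\Phi^{-1}(U)=U$ has $\mu(U)\in\{0,1\}$). If $h(\mu,\sigma)>h_{\max}$, where $h(\mu,\sigma)$ is the Kolmogorov–Sinai entropy of the measure-preserving system $(A^{\mathbb N},\sigma,\mu)$ computed with logarithms to base $2$, then $\mu$ is the uniform Bernoulli measure on $A^{\mathbb N}$, under which the coordinates are independent and uniformly distributed on $A$. -/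

import Mathlib

open MeasureTheory ProbabilityTheory Filter

noncomputable section

namespace MultCA

/-- The shift map on one-sided sequences: `(σ a)_n = a_{n+1}`. -/
def shift {A : Type*} (a : ℕ → A) : ℕ → A := fun n => a (n + 1)

/-- The (unilateral) nearest neighbour multiplication cellular automaton:
`(Φ a)_n = a_n * a_{n+1}`. -/
def multCA {A : Type*} [Mul A] (a : ℕ → A) : ℕ → A := fun n => a n * a (n + 1)

/-- The uniform Bernoulli measure on `A^ℕ`: the coordinates are independent and uniformly
distributed on the finite set `A`. -/
def uniformMeasure (A : Type*) [MeasurableSpace A] : Measure (ℕ → A) :=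
  Measure.infinitePi fun _ : ℕ => uniformOn (Set.univ : Set A)

/-- A finite measurable partition of `X` into cells indexed by `Fin k` is encoded by the measurable
map `f : X → Fin k` that sends a point to the index of its cell (empty cells are harmless).
`blockEntropy T μ f n` is the Shannon entropy, in bits, of the join of
`f, f ∘ T, …, f ∘ T^(n-1)`. -/
def blockEntropy {X : Type*} [MeasurableSpace X] (T : X → X) (μ : Measure X) {k : ℕ}
    (f : X → Fin k) (n : ℕ) : ℝ :=
  -∑ w : Fin n → Fin k,
    μ.real {x | ∀ i : Fin n, f (T^[(i : ℕ)] x) = w i} *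
      Real.logb 2 (μ.real {x | ∀ i : Fin n, f (T^[(i : ℕ)] x) = w i})

/-- The entropy of `T` relative to the partition `f`: the limit of `blockEntropy T μ f n / n`. For a
measure-preserving `T` the limit exists, so the upper limit taken here is the limit. -/
def partitionEntropy {X : Type*} [MeasurableSpace X] (T : X → X) (μ : Measure X) {k : ℕ}
    (f : X → Fin k) : EReal :=
  limsup (fun n : ℕ => ((blockEntropy T μ f n / (n : ℝ) : ℝ) : EReal)) atTop

/-- The Kolmogorov–Sinai (measure-theoretic) entropy, in bits: the supremum, over all finite
measurable partitions, of the entropy of `T` relative to the partition. -/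
def entropy {X : Type*} [MeasurableSpace X] (T : X → X) (μ : Measure X) : EReal :=
  ⨆ (k : ℕ) (f : X → Fin k) (_ : Measurable f), partitionEntropy T μ f

/-- The largest value of `log₂ |C|` over the proper subgroups `C` of the finite group `A`
(it is `0` if there are none, that is, if `A` is trivial). -/
def hMax (A : Type*) [Group A] : ℝ :=
  sSup {r : ℝ | ∃ C : Subgroup A, C ≠ ⊤ ∧ r = Real.logb 2 (Nat.card C)}

end MultCA

end

/-!
Let `p c` be the conditional law of `a 0` given `shift a = c`. Since `Φ` multiplies `a 0` on the
right by `(shift a) 0`, the `L²` distance between `p (Φ c)` and the right translate of `p c` by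
`c 0` can be computed from the `Φ`-invariance of `μ`, and it vanishes. Therefore the translate of
`p (shift a)` by `(a 0)⁻¹` is `Φ`-invariant, and by ergodicity it is a constant law `η`. Since
`a 0` itself has law `p (shift a)`, `η` is invariant under right translation by its own atoms, so
it is uniform on a subgroup `C`, and the tail of `a` determines the right coset `C * a 0`. One
symbol then carries at most `log₂ |C|` bits beyond its tail, so `h(μ, σ) ≤ log₂ |C|`. The entropy
hypothesis rules out every proper `C`, and for `C = A` the coordinates are independent and uniform.
-/

namespace MultCA

section ShannonEntropy

variable {Ω S T : Type*} [MeasurableSpace Ω] {μ : Measure Ω}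

section Finite

variable [Finite S] [MeasurableSpace S] [MeasurableSingletonClass S] [IsFiniteMeasure μ]

lemma integrable_comp_of_finite {X : Ω → S} (hX : Measurable X) (g : S → ℝ) :
    Integrable (fun ω => g (X ω)) μ :=
  Integrable.of_finite.comp_measurable hX

lemma ae_measureReal_preimage_singleton_pos {X : Ω → S} (hX : Measurable X) :
    ∀ᵐ ω ∂μ, 0 < μ.real (X ⁻¹' {X ω}) := by
  have hmap : ∀ᵐ s ∂μ.map X, 0 < μ.real (X ⁻¹' {s}) :=
    (ae_iff_of_countable).2 fun s hs => by
      rw [Measure.map_apply hX (measurableSet_singleton s)] at hs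
      exact ENNReal.toReal_pos hs (by finiteness)
  exact ae_of_ae_map hX.aemeasurable hmap

end Finite

variable [Fintype S] [Fintype T]

/-- The Shannon entropy, in nats, of a random variable with finitely many values. -/
noncomputable def shannonEntropy (μ : Measure Ω) (X : Ω → S) : ℝ :=
  ∑ s, Real.negMulLog (μ.real (X ⁻¹' {s}))

lemma shannonEntropy_congr_ae {X Y : Ω → S} (h : X =ᵐ[μ] Y) :
    shannonEntropy μ X = shannonEntropy μ Y := by
  refine Finset.sum_congr rfl fun s _ => congrArg Real.negMulLog (measureReal_congr ?_)
  filter_upwards [h] with ω hω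
  exact congrArg (· = s) hω

variable [MeasurableSpace S] [MeasurableSingletonClass S]

lemma shannonEntropy_comp_measurePreserving {τ : Ω → Ω} (hτ : MeasurePreserving τ μ μ) {X : Ω → S}
    (hX : Measurable X) : shannonEntropy μ (fun ω => X (τ ω)) = shannonEntropy μ X :=
  Finset.sum_congr rfl fun s _ => congrArg Real.negMulLog
    (hτ.measureReal_preimage (hX (measurableSet_singleton s)).nullMeasurableSet)

lemma sum_measureReal_preimage_singleton_mul [IsFiniteMeasure μ] {X : Ω → S} (hX : Measurable X)
    (g : S → ℝ) : ∑ s, μ.real (X ⁻¹' {s}) * g s = ∫ ω, g (X ω) ∂μ := by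
  rw [← integral_map hX.aemeasurable .of_discrete, integral_fintype .of_finite]
  simp only [map_measureReal_apply hX (measurableSet_singleton _), smul_eq_mul]

lemma shannonEntropy_eq_integral [IsFiniteMeasure μ] {X : Ω → S} (hX : Measurable X) :
    shannonEntropy μ X = ∫ ω, -Real.log (μ.real (X ⁻¹' {X ω})) ∂μ := by
  rw [← sum_measureReal_preimage_singleton_mul hX fun s => -Real.log (μ.real (X ⁻¹' {s}))]
  simp only [shannonEntropy, Real.negMulLog, neg_mul, mul_neg]

variable [IsProbabilityMeasure μ]

lemma shannonEntropy_le_integral_neg_log {X : Ω → S} (hX : Measurable X) {q : S → ℝ}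
    (hq : ∀ s, 0 ≤ q s) (hsum : ∑ s, q s ≤ 1) (hpos : ∀ᵐ ω ∂μ, 0 < q (X ω)) :
    shannonEntropy μ X ≤ ∫ ω, -Real.log (q (X ω)) ∂μ := by
  let p : S → ℝ := fun s => μ.real (X ⁻¹' {s})
  have hratio : ∫ ω, (q (X ω) / p (X ω) - 1) ∂μ ≤ 0 := by
    rw [integral_sub (integrable_comp_of_finite hX fun s => q s / p s) (integrable_const 1),
      ← sum_measureReal_preimage_singleton_mul hX fun s => q s / p s]
    have hterm : ∑ s, p s * (q s / p s) ≤ ∑ s, q s := Finset.sum_le_sum fun s _ => by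
      rcases eq_or_ne (p s) 0 with h | h
      · simpa only [h, zero_mul] using hq s
      · exact (mul_div_cancel₀ _ h).le
    simpa using hterm.trans hsum
  have hgibbs : ∀ᵐ ω ∂μ, -Real.log (p (X ω)) ≤ -Real.log (q (X ω)) + (q (X ω) / p (X ω) - 1) := by
    filter_upwards [hpos, ae_measureReal_preimage_singleton_pos hX] with ω hqω hpω
    have := Real.log_le_sub_one_of_pos (div_pos hqω hpω)
    rw [Real.log_div hqω.ne' hpω.ne'] at this
    linarith
  have hint := integral_mono_ae (integrable_comp_of_finite hX fun s => -Real.log (p s))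
    (integrable_comp_of_finite hX fun s => -Real.log (q s) + (q s / p s - 1)) hgibbs
  rw [integral_add (integrable_comp_of_finite hX fun s => -Real.log (q s))
    (integrable_comp_of_finite hX fun s => q s / p s - 1)] at hint
  rw [shannonEntropy_eq_integral hX]
  linarith

lemma shannonEntropy_le_log_card {X : Ω → S} (hX : Measurable X) :
    shannonEntropy μ X ≤ Real.log (Fintype.card S) := by
  have : Nonempty S := (nonempty_of_isProbabilityMeasure μ).map X
  refine (shannonEntropy_le_integral_neg_log hX (q := fun _ => (Fintype.card S : ℝ)⁻¹)
    (fun _ => by positivity) (by simp) (.of_forall fun _ => by positivity)).trans_eq ?_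
  simp

omit [MeasurableSpace S] [MeasurableSingletonClass S]
variable [MeasurableSpace T] [MeasurableSingletonClass T]

lemma shannonEntropy_comp_le {Y : Ω → T} (hY : Measurable Y) (φ : T → S) :
    shannonEntropy μ (fun ω => φ (Y ω)) ≤ shannonEntropy μ Y := by
  let _ : MeasurableSpace S := ⊤
  have hφY : Measurable fun ω => φ (Y ω) := (Measurable.of_discrete (f := φ)).comp hY
  rw [shannonEntropy_eq_integral hφY, shannonEntropy_eq_integral hY]
  refine integral_mono_ae
    (integrable_comp_of_finite hY fun t => -Real.log (μ.real ((fun ω => φ (Y ω)) ⁻¹' {φ t})))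
    (integrable_comp_of_finite hY fun t => -Real.log (μ.real (Y ⁻¹' {t}))) ?_
  filter_upwards [ae_measureReal_preimage_singleton_pos hY] with ω hω
  exact neg_le_neg (Real.log_le_log hω (measureReal_mono fun ω' hω' => congrArg φ hω'))

lemma shannonEntropy_le_of_factorsThrough {X : Ω → S} {Y : Ω → T} (hY : Measurable Y) {G : Set Ω}
    (hG : ∀ᵐ ω ∂μ, ω ∈ G) (h : Function.FactorsThrough (G.domRestrict X) (G.domRestrict Y)) :
    shannonEntropy μ X ≤ shannonEntropy μ Y := by
  have : Nonempty S := (nonempty_of_isProbabilityMeasure μ).map X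
  obtain ⟨φ, hφ⟩ := (Function.factorsThrough_iff _).1 h
  have hX : X =ᵐ[μ] fun ω => φ (Y ω) := by
    filter_upwards [hG] with ω hω using congrFun hφ ⟨ω, hω⟩
  exact (shannonEntropy_congr_ae hX).trans_le (shannonEntropy_comp_le hY φ)

variable [MeasurableSpace S] [MeasurableSingletonClass S]

lemma shannonEntropy_prodMk_le {X : Ω → S} {Y : Ω → T} (hX : Measurable X) (hY : Measurable Y) :
    shannonEntropy μ (fun ω => (X ω, Y ω)) ≤ shannonEntropy μ X + shannonEntropy μ Y := by
  let p : S → ℝ := fun s => μ.real (X ⁻¹' {s})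
  let q : T → ℝ := fun t => μ.real (Y ⁻¹' {t})
  have hp : ∑ s, p s = 1 := by simpa using sum_measureReal_preimage_singleton_mul (μ := μ) hX 1
  have hq : ∑ t, q t = 1 := by simpa using sum_measureReal_preimage_singleton_mul (μ := μ) hY 1
  have hpos := (ae_measureReal_preimage_singleton_pos (μ := μ) hX).and
    (ae_measureReal_preimage_singleton_pos (μ := μ) hY)
  calc shannonEntropy μ (fun ω => (X ω, Y ω))
      ≤ ∫ ω, -Real.log (p (X ω) * q (Y ω)) ∂μ := by
        refine shannonEntropy_le_integral_neg_log (hX.prodMk hY) (q := fun w => p w.1 * q w.2)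
          (fun w => by positivity) ?_ (hpos.mono fun ω hω => mul_pos hω.1 hω.2)
        rw [Fintype.sum_prod_type, ← Fintype.sum_mul_sum, hp, hq, one_mul]
    _ = ∫ ω, (-Real.log (p (X ω)) + -Real.log (q (Y ω))) ∂μ := by
        refine integral_congr_ae (hpos.mono fun ω hω => ?_)
        dsimp only
        rw [Real.log_mul hω.1.ne' hω.2.ne', neg_add]
    _ = shannonEntropy μ X + shannonEntropy μ Y := by
        rw [integral_add (integrable_comp_of_finite hX fun s => -Real.log (p s))
          (integrable_comp_of_finite hY fun t => -Real.log (q t)),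
          shannonEntropy_eq_integral hX, shannonEntropy_eq_integral hY]

omit [Fintype S] [MeasurableSpace S] [MeasurableSingletonClass S] in
lemma shannonEntropy_pi_le {ι : Type*} [Fintype ι] [DecidableEq ι] {S : ι → Type*}
    [∀ i, Fintype (S i)] [∀ i, MeasurableSpace (S i)] [∀ i, MeasurableSingletonClass (S i)]
    {X : ∀ i, Ω → S i} (hX : ∀ i, Measurable (X i)) :
    shannonEntropy μ (fun ω i => X i ω) ≤ ∑ i, shannonEntropy μ (X i) := by
  let p : ∀ i, S i → ℝ := fun i s => μ.real (X i ⁻¹' {s})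
  have hp : ∀ i, ∑ s, p i s = 1 := fun i => by
    simpa using sum_measureReal_preimage_singleton_mul (μ := μ) (hX i) 1
  have hpos := ae_all_iff.2 fun i => ae_measureReal_preimage_singleton_pos (μ := μ) (hX i)
  calc shannonEntropy μ (fun ω i => X i ω)
      ≤ ∫ ω, -Real.log (∏ i, p i (X i ω)) ∂μ := by
        refine shannonEntropy_le_integral_neg_log (measurable_pi_lambda _ hX)
          (q := fun w => ∏ i, p i (w i)) (fun w => Finset.prod_nonneg fun i _ => measureReal_nonneg)
          ?_ (hpos.mono fun ω hω => Finset.prod_pos fun i _ => hω i)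
        simp only [← Fintype.prod_sum, hp, Finset.prod_const_one, le_refl]
    _ = ∫ ω, ∑ i, -Real.log (p i (X i ω)) ∂μ := by
        refine integral_congr_ae (hpos.mono fun ω hω => ?_)
        dsimp only
        rw [Real.log_prod fun i _ => (hω i).ne', Finset.sum_neg_distrib]
    _ = ∑ i, shannonEntropy μ (X i) := by
        rw [integral_finsetSum _ fun i _ =>
          integrable_comp_of_finite (hX i) fun s => -Real.log (p i s)]
        exact Finset.sum_congr rfl fun i _ => (shannonEntropy_eq_integral (hX i)).symm

omit [Fintype S] [Fintype T] [MeasurableSpace S] [MeasurableSingletonClass S]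
  [MeasurableSpace T] [MeasurableSingletonClass T] in
lemma shannonEntropy_mem_eq_binEntropy {D : Set Ω} (hD : MeasurableSet D) :
    shannonEntropy μ (fun ω => ω ∈ D) = Real.binEntropy (μ.real D) := by
  have htrue : (fun ω => ω ∈ D) ⁻¹' {True} = D := by ext; simp
  have hfalse : (fun ω => ω ∈ D) ⁻¹' {False} = Dᶜ := by ext; simp
  rw [shannonEntropy, Real.binEntropy_eq_negMulLog_add_negMulLog_one_sub,
    ← probReal_compl_eq_one_sub hD]
  simp [Fintype.univ_Prop, htrue, hfalse]

end ShannonEntropy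

section KolmogorovSinaiEntropy

variable {X : Type*} [MeasurableSpace X] {T : X → X} {μ : Measure X} {k : ℕ} {f : X → Fin k}

lemma blockEntropy_eq_shannonEntropy_div (n : ℕ) : blockEntropy T μ f n =
    shannonEntropy μ (fun x (i : Fin n) => f (T^[(i : ℕ)] x)) / Real.log 2 := by
  have hset : ∀ w : Fin n → Fin k, {x | ∀ i : Fin n, f (T^[(i : ℕ)] x) = w i} =
      (fun x (i : Fin n) => f (T^[(i : ℕ)] x)) ⁻¹' {w} := fun w => by
    ext x
    exact funext_iff.symm
  simp_rw [blockEntropy, shannonEntropy, hset, Real.negMulLog, Real.logb, neg_mul,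
    Finset.sum_neg_distrib, neg_div, Finset.sum_div, mul_div_assoc]

lemma partitionEntropy_le_of_blockEntropy_le {h β : ℝ}
    (hle : ∀ n : ℕ, blockEntropy T μ f n ≤ n * h + β) : partitionEntropy T μ f ≤ (h : EReal) := by
  have hlim : Tendsto (fun n : ℕ => (n * h + β) / (n : ℝ)) atTop (nhds h) := by
    have hβ := (tendsto_const_div_atTop_nhds_zero_nat β).const_add h
    rw [add_zero] at hβ
    refine hβ.congr' ?_
    filter_upwards [eventually_ne_atTop 0] with n hn
    field_simp
  calc partitionEntropy T μ f
      ≤ limsup (fun n : ℕ => (((n * h + β) / (n : ℝ) : ℝ) : EReal)) atTop :=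
        limsup_le_limsup (.of_forall fun n => EReal.coe_le_coe_iff.2
          (div_le_div_of_nonneg_right (hle n) n.cast_nonneg))
    _ = h := ((continuous_coe_real_ereal.tendsto h).comp hlim).limsup_eq

variable [IsProbabilityMeasure μ] {S U : Type*} [Fintype S] [MeasurableSpace S]
  [MeasurableSingletonClass S] [Finite U] [MeasurableSpace U] [MeasurableSingletonClass U]

-- The remainder `R n` takes boundedly many values, so it costs nothing in the limit.
lemma partitionEntropy_le_of_determined (hT : MeasurePreserving T μ μ) {Z : X → S}
    (hZ : Measurable Z) {R : ℕ → X → U} (hR : ∀ n, Measurable (R n)) {G : Set X}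
    (hG : ∀ᵐ x ∂μ, x ∈ G)
    (hdet : ∀ n, ∀ x ∈ G, ∀ y ∈ G, (∀ i < n, Z (T^[i] x) = Z (T^[i] y)) → R n x = R n y →
      ∀ i < n, f (T^[i] x) = f (T^[i] y)) :
    partitionEntropy T μ f ≤ ((shannonEntropy μ Z / Real.log 2 : ℝ) : EReal) := by
  have := Fintype.ofFinite U
  refine partitionEntropy_le_of_blockEntropy_le (β := Real.log (Fintype.card U) / Real.log 2)
    fun n => ?_
  rw [blockEntropy_eq_shannonEntropy_div, ← mul_div_assoc, ← add_div]
  gcongr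
  have hZT : ∀ i : Fin n, Measurable fun x => Z (T^[(i : ℕ)] x) := fun i =>
    hZ.comp (hT.measurable.iterate i)
  have hW : Measurable fun x (i : Fin n) => Z (T^[(i : ℕ)] x) := measurable_pi_lambda _ hZT
  calc shannonEntropy μ (fun x (i : Fin n) => f (T^[(i : ℕ)] x))
      ≤ shannonEntropy μ (fun x => (fun i : Fin n => Z (T^[(i : ℕ)] x), R n x)) := by
        refine shannonEntropy_le_of_factorsThrough (hW.prodMk (hR n)) hG ?_
        rintro ⟨x, hx⟩ ⟨y, hy⟩ hxy
        obtain ⟨hZxy, hRxy⟩ := Prod.ext_iff.1 hxy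
        exact funext fun i =>
          hdet n x hx y hy (fun j hj => congrFun hZxy ⟨j, hj⟩) hRxy i i.2
    _ ≤ shannonEntropy μ (fun x (i : Fin n) => Z (T^[(i : ℕ)] x)) + shannonEntropy μ (R n) :=
        shannonEntropy_prodMk_le hW (hR n)
    _ ≤ ∑ i : Fin n, shannonEntropy μ (fun x => Z (T^[(i : ℕ)] x)) + Real.log (Fintype.card U) :=
        add_le_add (shannonEntropy_pi_le hZT) (shannonEntropy_le_log_card (hR n))
    _ = n * shannonEntropy μ Z + Real.log (Fintype.card U) := by
        simp only [shannonEntropy_comp_measurePreserving (hT.iterate _) hZ, Finset.sum_const,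
          Finset.card_univ, Fintype.card_fin, nsmul_eq_mul]

end KolmogorovSinaiEntropy

section Shift

variable {A : Type*}

lemma shift_iterate_apply (i j : ℕ) (a : ℕ → A) : shift^[i] a j = a (i + j) := by
  induction i generalizing a with
  | zero => simp
  | succ i ih =>
    rw [Function.iterate_succ_apply, ih, shift]
    congr 1
    omega

variable [MeasurableSpace A] {μ : Measure (ℕ → A)}

lemma exists_dependsOn_measureReal_symmDiff_lt [IsFiniteMeasure μ] {L : Set (ℕ → A)}
    (hL : MeasurableSet L) {δ : ℝ} (hδ : 0 < δ) :
    ∃ (M : ℕ) (E : Set (ℕ → A)), MeasurableSet E ∧ DependsOn (· ∈ E) (Set.Iio M) ∧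
      μ.real (symmDiff L E) < δ := by
  obtain ⟨E, hE, hlt⟩ := (Measure.MeasureDense.of_generateFrom_isSetAlgebra_finite (μ := μ)
    isSetAlgebra_measurableCylinders generateFrom_measurableCylinders.symm).approx
    L hL (by finiteness) δ hδ
  obtain ⟨s, B, -, rfl⟩ := (mem_measurableCylinders E).1 hE
  refine ⟨s.sup id + 1, _, MeasurableSet.of_mem_measurableCylinders hE, fun a b hab => ?_, ?_⟩
  · have hs : s.restrict a = s.restrict b := funext fun i =>
      hab i (Nat.lt_succ_of_le (Finset.le_sup (f := id) i.2))
    simp only [mem_cylinder, hs]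
  · exact ((ENNReal.toReal_lt_toReal (by finiteness) (by finiteness)).2 hlt).trans_eq
      (ENNReal.toReal_ofReal hδ.le)

lemma exists_pos_forall_binEntropy_le {ε : ℝ} (hε : 0 < ε) :
    ∃ δ > 0, ∀ t : ℝ, 0 ≤ t → t < δ → Real.binEntropy t ≤ ε := by
  obtain ⟨δ, hδ, h⟩ := Metric.continuous_iff.1 Real.binEntropy_continuous 0 ε hε
  refine ⟨δ, hδ, fun t ht htδ => ?_⟩
  have hdist := h t (by rwa [Real.dist_eq, sub_zero, abs_of_nonneg ht])
  rw [Real.binEntropy_zero, Real.dist_eq, sub_zero] at hdist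
  exact (le_abs_self _).trans hdist.le

-- `e` records on which of the level sets of `F` a cylinder approximation goes wrong.
lemma exists_shannonEntropy_le_forall_eq_of_prefix_eq [IsProbabilityMeasure μ] {U : Type*}
    [Fintype U] [DecidableEq U] [MeasurableSpace U] [MeasurableSingletonClass U] {F : (ℕ → A) → U}
    (hF : Measurable F) {ε : ℝ} (hε : 0 < ε) :
    ∃ (M : ℕ) (e : (ℕ → A) → U → Prop), Measurable e ∧ shannonEntropy μ e ≤ ε ∧
      ∀ a b, (∀ i < M, a i = b i) → e a = e b → F a = F b := by
  have : Nonempty U := (nonempty_of_isProbabilityMeasure μ).map F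
  have hcard : (0 : ℝ) < Fintype.card U := by positivity
  obtain ⟨δ, hδ, hbin⟩ := exists_pos_forall_binEntropy_le (div_pos hε hcard)
  have hL : ∀ u, MeasurableSet (F ⁻¹' {u}) := fun u => hF (measurableSet_singleton u)
  choose M E hE hdep hlt using fun u =>
    exists_dependsOn_measureReal_symmDiff_lt (μ := μ) (hL u) hδ
  have hD : ∀ u, MeasurableSet (symmDiff (F ⁻¹' {u}) (E u)) := fun u => (hL u).symmDiff (hE u)
  refine ⟨Finset.univ.sup M, fun a u => a ∈ symmDiff (F ⁻¹' {u}) (E u),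
    measurable_pi_lambda _ fun u => measurable_mem.2 (hD u), ?_, fun a b hab he => ?_⟩
  · calc shannonEntropy μ (fun a u => a ∈ symmDiff (F ⁻¹' {u}) (E u))
        ≤ ∑ u, shannonEntropy μ (fun a => a ∈ symmDiff (F ⁻¹' {u}) (E u)) :=
          shannonEntropy_pi_le fun u => measurable_mem.2 (hD u)
      _ ≤ ∑ _u : U, ε / Fintype.card U := Finset.sum_le_sum fun u _ =>
          (shannonEntropy_mem_eq_binEntropy (hD u)).trans_le (hbin _ measureReal_nonneg (hlt u))
      _ = ε := by
          rw [Finset.sum_const, Finset.card_univ, nsmul_eq_mul, mul_div_cancel₀ _ hcard.ne']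
  · have hmem : a ∈ E (F a) ↔ b ∈ E (F a) := iff_of_eq <| hdep (F a) fun i hi =>
      hab i (hi.trans_le (Finset.le_sup (Finset.mem_univ (F a))))
    have hdiff := congrFun he (F a)
    simp only [Set.mem_symmDiff, Set.mem_preimage, Set.mem_singleton_iff, hmem, eq_iff_iff] at hdiff
    by_contra hne
    grind

omit [MeasurableSpace A] in
lemma forall_iterate_shift_eq_of_tail_eq {U V S : Type*} {F : (ℕ → A) → U} {e : (ℕ → A) → V}
    {κ : A → S} {M n : ℕ} {a b : ℕ → A}
    (he : ∀ x y : ℕ → A, (∀ i < M, x i = y i) → e x = e y → F x = F y)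
    (hstep : ∀ i < n, F (shift^[i + 1] a) = F (shift^[i + 1] b) → κ (a i) = κ (b i) → a i = b i)
    (heq : ∀ i ≤ n, e (shift^[i] a) = e (shift^[i] b)) (hκ : ∀ i < n, κ (a i) = κ (b i))
    (htail : ∀ j < M, a (n + j) = b (n + j)) :
    ∀ i ≤ n, F (shift^[i] a) = F (shift^[i] b) := by
  have hF : ∀ i ≤ n, (∀ j, i ≤ j → j < n + M → a j = b j) →
      F (shift^[i] a) = F (shift^[i] b) := fun i hi hab =>
    he _ _ (fun j hj => by
      rw [shift_iterate_apply, shift_iterate_apply]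
      exact hab _ (by omega) (by omega)) (heq i hi)
  suffices hab : ∀ i ≤ n, ∀ j, i ≤ j → j < n + M → a j = b j from fun i hi => hF i hi (hab i hi)
  intro i hi
  induction hi using Nat.decreasingInduction with
  | self =>
    intro j hnj hj
    obtain ⟨l, rfl⟩ := Nat.exists_eq_add_of_le hnj
    exact htail l (by omega)
  | of_succ i hin ih =>
    intro j hij hj
    rcases hij.eq_or_lt with rfl | hij
    · exact hstep i hin (hF (i + 1) hin ih) (hκ i hin)
    · exact ih j hij hj

variable [Finite A] [DiscreteMeasurableSpace A]

variable [IsProbabilityMeasure μ] {Q S : Type*} [Finite Q] [MeasurableSpace Q]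
  [MeasurableSingletonClass Q] [Finite S] {π : A → Q} {κ : A → S} {q : (ℕ → A) → Q}

lemma partitionEntropy_shift_le_logb_card_add (hσ : MeasurePreserving shift μ μ)
    (hπκ : Function.Injective fun x => (π x, κ x)) (hq : Measurable q)
    (hqπ : ∀ᵐ a ∂μ, q (shift a) = π (a 0)) {k : ℕ} {f : (ℕ → A) → Fin k} (hf : Measurable f)
    {ε : ℝ} (hε : 0 < ε) :
    partitionEntropy shift μ f ≤ ((Real.logb 2 (Nat.card S) + ε : ℝ) : EReal) := by
  classical
  have := Fintype.ofFinite Q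
  have := Fintype.ofFinite S
  let _ : MeasurableSpace S := ⊤
  have hlog2 : 0 < Real.log 2 := Real.log_pos one_lt_two
  obtain ⟨M, e, he, hesmall, hdet⟩ :=
    exists_shannonEntropy_le_forall_eq_of_prefix_eq (μ := μ) (hq.prodMk hf) (mul_pos hε hlog2)
  have hκ : Measurable fun a : ℕ → A => κ (a 0) :=
    (Measurable.of_discrete (f := κ)).comp (measurable_pi_apply 0)
  have hG : ∀ᵐ a ∂μ, ∀ i, q (shift^[i + 1] a) = π (a i) := ae_all_iff.2 fun i => by
    filter_upwards [(hσ.iterate i).quasiMeasurePreserving.ae hqπ] with a ha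
    rw [Function.iterate_succ_apply', ha, shift_iterate_apply, add_zero]
  refine (partitionEntropy_le_of_determined hσ (hκ.prodMk he)
    (R := fun n a => (e (shift^[n] a), fun j : Fin M => a (n + j)))
    (fun n => (he.comp (hσ.measurable.iterate n)).prodMk
      (measurable_pi_lambda _ fun j => measurable_pi_apply _)) hG ?_).trans ?_
  · intro n a ha b hb hZ hR i hi
    simp only [Prod.mk.injEq, shift_iterate_apply, add_zero] at hZ hR
    have hstep : ∀ i < n, (q (shift^[i + 1] a), f (shift^[i + 1] a)) =
        (q (shift^[i + 1] b), f (shift^[i + 1] b)) → κ (a i) = κ (b i) → a i = b i := by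
      intro i _ hqf hκi
      refine hπκ (Prod.ext ?_ hκi)
      simpa only [ha i, hb i] using congrArg Prod.fst hqf
    have heq : ∀ i ≤ n, e (shift^[i] a) = e (shift^[i] b) := fun i hi =>
      hi.eq_or_lt.elim (fun h => h ▸ hR.1) fun h => (hZ i h).2
    exact congrArg Prod.snd (forall_iterate_shift_eq_of_tail_eq hdet hstep heq
      (fun i hi => (hZ i hi).1) (fun j hj => congrFun hR.2 ⟨j, hj⟩) i hi.le)
  · rw [EReal.coe_le_coe_iff, div_le_iff₀ hlog2, add_mul, Real.logb, div_mul_cancel₀ _ hlog2.ne',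
      Nat.card_eq_fintype_card]
    exact (shannonEntropy_prodMk_le hκ he).trans
      (add_le_add (shannonEntropy_le_log_card hκ) hesmall)

lemma entropy_shift_le_logb_card (hσ : MeasurePreserving shift μ μ)
    (hπκ : Function.Injective fun x => (π x, κ x)) (hq : Measurable q)
    (hqπ : ∀ᵐ a ∂μ, q (shift a) = π (a 0)) :
    entropy shift μ ≤ ((Real.logb 2 (Nat.card S) : ℝ) : EReal) := by
  refine iSup_le fun k => iSup_le fun f => iSup_le fun hf => EReal.le_of_forall_lt_iff_le.1 ?_
  intro z hz
  have hε : 0 < z - Real.logb 2 (Nat.card S) := sub_pos.2 (EReal.coe_lt_coe_iff.1 hz)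
  simpa only [add_sub_cancel] using partitionEntropy_shift_le_logb_card_add hσ hπκ hq hqπ hf hε

end Shift

section Coset

variable {A : Type*} [Group A]

open scoped Pointwise in
lemma exists_injective_rightCoset_prodMk (C : Subgroup A) :
    ∃ κ : A → C, Function.Injective fun x => (MulOpposite.op x • (C : Set A), κ x) := by
  let coset : A → Set A := fun x => MulOpposite.op x • (C : Set A)
  let rep : Set A → A := Function.invFun coset
  have hrep : ∀ x, coset (rep (coset x)) = coset x := fun x => Function.invFun_eq ⟨x, rfl⟩
  refine ⟨fun x => ⟨x * (rep (coset x))⁻¹, (rightCoset_eq_iff C).1 (hrep x)⟩, fun x y hxy => ?_⟩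
  obtain ⟨hcoset, hκ⟩ := Prod.ext_iff.1 hxy
  have hκ' : x * (rep (coset x))⁻¹ = y * (rep (coset y))⁻¹ := congrArg Subtype.val hκ
  rw [show coset x = coset y from hcoset] at hκ'
  exact mul_right_cancel hκ'

lemma logb_card_le_hMax [Finite A] {C : Subgroup A} (hC : C ≠ ⊤) :
    Real.logb 2 (Nat.card C) ≤ hMax A := by
  refine le_csSup (Set.Finite.bddAbove ?_) ⟨C, hC, rfl⟩
  refine (Set.finite_range fun C : Subgroup A => Real.logb 2 (Nat.card C)).subset ?_
  rintro r ⟨C, -, rfl⟩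
  exact ⟨C, rfl⟩

end Coset

section DiscreteMeasure

variable {A : Type*} [MeasurableSpace A] [DiscreteMeasurableSpace A]

lemma measurable_measureReal_singleton [Countable A] {X : Type*} [MeasurableSpace X]
    {ρ : X → Measure A} (hρ : Measurable ρ) :
    Measurable fun z : X × A => (ρ z.1).real {z.2} :=
  measurable_from_prod_countable_left fun x =>
    ((Measure.measurable_coe (measurableSet_singleton x)).comp hρ).ennreal_toReal

lemma measurableSet_measure_eq [Countable A] {X : Type*} [MeasurableSpace X]
    {ρ₁ ρ₂ : X → Measure A} (h₁ : Measurable ρ₁) (h₂ : Measurable ρ₂) :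
    MeasurableSet {x | ρ₁ x = ρ₂ x} := by
  simp only [Measure.ext_iff_singleton, Set.ofPred_forall]
  exact .iInter fun y => measurableSet_eq_fun
    ((Measure.measurable_coe (measurableSet_singleton y)).comp h₁)
    ((Measure.measurable_coe (measurableSet_singleton y)).comp h₂)

variable [Group A]

lemma map_mul_right_apply_singleton (ν : Measure A) (g x : A) :
    ν.map (· * g) {x} = ν {x * g⁻¹} := by
  rw [Measure.map_apply .of_discrete (measurableSet_singleton x)]
  congr 1
  ext y
  simp [eq_mul_inv_iff_mul_eq]

lemma map_mul_right_map_mul_right (ν : Measure A) (g h : A) :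
    (ν.map (· * g)).map (· * h) = ν.map (· * (g * h)) := by
  rw [Measure.map_map .of_discrete .of_discrete]
  simp only [Function.comp_def, mul_assoc]

lemma measurable_measure_map_mul_right [Countable A] {X : Type*} [MeasurableSpace X]
    {ρ : X → Measure A} (hρ : Measurable ρ) {g : X → A} (hg : Measurable g) :
    Measurable fun x => (ρ x).map (· * g x) := by
  have hjoint : Measurable fun z : X × A => (ρ z.1).map (· * z.2) :=
    measurable_from_prod_countable_left fun h =>
      ((Measure.measurable_map (· * h) .of_discrete).comp hρ :)
  exact hjoint.comp (measurable_id.prodMk hg)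

end DiscreteMeasure

section MassVector

lemma ae_eq_of_integral_inner_eq {X E : Type*} [MeasurableSpace X] {μ : Measure X}
    [NormedAddCommGroup E] [InnerProductSpace ℝ E] {u v : X → E} (hu : MemLp u 2 μ)
    (hv : MemLp v 2 μ) (hinner : ∫ x, inner ℝ (u x) (v x) ∂μ = ∫ x, ‖u x‖ ^ 2 ∂μ)
    (hnorm : ∫ x, ‖v x‖ ^ 2 ∂μ = ∫ x, ‖u x‖ ^ 2 ∂μ) : u =ᵐ[μ] v := by
  have hu2 := hu.integrable_norm_pow two_ne_zero
  have hv2 := hv.integrable_norm_pow two_ne_zero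
  have huv := (hu.sub hv).integrable_norm_pow two_ne_zero
  simp only [Pi.sub_apply] at huv
  have hpolar : ∀ x, inner ℝ (u x) (v x) = (‖u x‖ ^ 2 + ‖v x‖ ^ 2 - ‖u x - v x‖ ^ 2) / 2 :=
    fun x => by rw [norm_sub_sq_real]; ring
  have hzero : ∫ x, ‖u x - v x‖ ^ 2 ∂μ = 0 := by
    simp only [hpolar] at hinner
    rw [integral_div, integral_sub (f := fun x => ‖u x‖ ^ 2 + ‖v x‖ ^ 2) (hu2.add hv2) huv,
      integral_add hu2 hv2, hnorm] at hinner
    linarith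
  filter_upwards [(integral_eq_zero_iff_of_nonneg (fun x => by positivity) huv).1 hzero] with x hx
  simpa [sub_eq_zero] using hx

variable {A : Type*} [MeasurableSpace A]

/-- The mass function of a measure on a finite set, as a vector of Euclidean space: this makes the
strict convexity of the `L²` norm available for families of measures. -/
noncomputable def massVector (ν : Measure A) : EuclideanSpace ℝ A :=
  WithLp.toLp 2 fun x => ν.real {x}

lemma massVector_inj [Countable A] {ν ρ : Measure A} [IsFiniteMeasure ν] [IsFiniteMeasure ρ] :
    massVector ν = massVector ρ ↔ ν = ρ := by
  refine ⟨fun h => Measure.ext_of_singleton fun x => ?_, congrArg massVector⟩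
  exact (measureReal_eq_measureReal_iff).1 (congrFun (congrArg WithLp.ofLp h) x)

variable [DiscreteMeasurableSpace A]

lemma measurable_massVector : Measurable (massVector (A := A)) :=
  (WithLp.measurable_toLp 2 _).comp <| measurable_pi_lambda _ fun x =>
    (Measure.measurable_coe (measurableSet_singleton x)).ennreal_toReal

variable [Fintype A]

lemma inner_massVector (ν ρ : Measure A) [IsFiniteMeasure ν] :
    inner ℝ (massVector ν) (massVector ρ) = ∫ x, ρ.real {x} ∂ν := by
  rw [integral_fintype .of_finite, PiLp.inner_apply]
  exact Finset.sum_congr rfl fun x _ => mul_comm _ _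

lemma norm_massVector_le_one (ν : Measure A) [IsProbabilityMeasure ν] : ‖massVector ν‖ ≤ 1 := by
  rw [← sq_le_one_iff₀ (norm_nonneg _), ← real_inner_self_eq_norm_sq, inner_massVector]
  calc ∫ x, ν.real {x} ∂ν ≤ ∫ _x, 1 ∂ν :=
        integral_mono .of_finite .of_finite fun x => measureReal_le_one
    _ = 1 := by simp

lemma memLp_massVector {X : Type*} [MeasurableSpace X] {μ : Measure X} [IsFiniteMeasure μ]
    {ρ : X → Measure A} (hρ : Measurable ρ) [∀ x, IsProbabilityMeasure (ρ x)] :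
    MemLp (fun x => massVector (ρ x)) 2 μ :=
  .of_bound (measurable_massVector.comp hρ).aestronglyMeasurable 1
    (.of_forall fun x => norm_massVector_le_one (ρ x))

variable [Group A]

lemma norm_massVector_map_mul_right (ν : Measure A) (g : A) :
    ‖massVector (ν.map (· * g))‖ = ‖massVector ν‖ := by
  simp only [EuclideanSpace.norm_eq, massVector, measureReal_def, map_mul_right_apply_singleton]
  congr 1
  exact Equiv.sum_comp (Equiv.mulRight g⁻¹) fun x => ‖(ν {x}).toReal‖ ^ 2

end MassVector

section TailLaw

variable {A : Type*} [MeasurableSpace A] [Nonempty A] {μ : Measure (ℕ → A)} [IsFiniteMeasure μ]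

section StandardBorel

variable [StandardBorelSpace A]

/-- The conditional law of the coordinate `a 0` given the tail `shift a`. -/
noncomputable def tailLaw (μ : Measure (ℕ → A)) [IsFiniteMeasure μ] : Kernel (ℕ → A) A :=
  condDistrib (fun a => a 0) shift μ

instance : IsMarkovKernel (tailLaw μ) :=
  inferInstanceAs (IsMarkovKernel (condDistrib _ _ _))

lemma compProd_tailLaw (hσ : MeasurePreserving shift μ μ) :
    μ ⊗ₘ tailLaw μ = μ.map fun a => (shift a, a 0) := by
  have h : μ.map shift ⊗ₘ tailLaw μ = μ.map fun a => (shift a, a 0) :=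
    compProd_map_condDistrib (measurable_pi_apply 0).aemeasurable
  rwa [hσ.map_eq] at h

end StandardBorel

lemma integral_inner_massVector_tailLaw [Fintype A] [DiscreteMeasurableSpace A]
    (hσ : MeasurePreserving shift μ μ) {ρ : (ℕ → A) → Measure A} (hρ : Measurable ρ)
    [∀ c, IsProbabilityMeasure (ρ c)] :
    ∫ c, inner ℝ (massVector (tailLaw μ c)) (massVector (ρ c)) ∂μ =
      ∫ a, (ρ (shift a)).real {a 0} ∂μ := by
  have hmeas := measurable_measureReal_singleton hρ
  have hint : Integrable (fun z : (ℕ → A) × A => (ρ z.1).real {z.2}) (μ ⊗ₘ tailLaw μ) :=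
    .of_bound hmeas.aestronglyMeasurable 1 (.of_forall fun z =>
      (abs_of_nonneg measureReal_nonneg).trans_le measureReal_le_one)
  simp only [inner_massVector]
  rw [← Measure.integral_compProd hint, compProd_tailLaw hσ,
    integral_map (hσ.measurable.prodMk (measurable_pi_apply 0)).aemeasurable
      hmeas.aestronglyMeasurable]

end TailLaw

section Rigidity

variable {A : Type*} [Group A] [Finite A] [MeasurableSpace A] [DiscreteMeasurableSpace A]
  {μ : Measure (ℕ → A)}

-- Translation preserves the `L²` norm, so only an inner product has to be computed: it is the mean
-- conditional mass of the coordinate at `0`, and `multCA` preserves that mean.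
lemma tailLaw_multCA [IsFiniteMeasure μ] (hσ : MeasurePreserving shift μ μ)
    (hΦ : MeasurePreserving multCA μ μ) :
    ∀ᵐ c ∂μ, tailLaw μ (multCA c) = (tailLaw μ c).map (· * c 0) := by
  have := Fintype.ofFinite A
  let ρ : (ℕ → A) → Measure A := fun c => (tailLaw μ (multCA c)).map (· * (c 0)⁻¹)
  have hρ : Measurable ρ := measurable_measure_map_mul_right
    ((tailLaw μ).measurable.comp hΦ.measurable) (measurable_pi_apply 0).inv
  have : ∀ c, IsProbabilityMeasure (ρ c) := fun c => Measure.isProbabilityMeasure_map (by fun_prop)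
  have hmass : Measurable fun c => massVector (tailLaw μ c) :=
    measurable_massVector.comp (tailLaw μ).measurable
  have hdiag : Measurable fun a => (tailLaw μ (shift a)).real {a 0} :=
    (measurable_measureReal_singleton (tailLaw μ).measurable).comp
      (hσ.measurable.prodMk (measurable_pi_apply 0))
  have hinner : ∫ c, inner ℝ (massVector (tailLaw μ c)) (massVector (ρ c)) ∂μ =
      ∫ c, ‖massVector (tailLaw μ c)‖ ^ 2 ∂μ := by
    simp only [← real_inner_self_eq_norm_sq]
    rw [integral_inner_massVector_tailLaw hσ hρ,
      integral_inner_massVector_tailLaw hσ (tailLaw μ).measurable]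
    calc ∫ a, (ρ (shift a)).real {a 0} ∂μ
        = ∫ a, (tailLaw μ (shift (multCA a))).real {multCA a 0} ∂μ := by
          simp only [ρ, measureReal_def, map_mul_right_apply_singleton, inv_inv]
          rfl
      _ = ∫ a, (tailLaw μ (shift a)).real {a 0} ∂μ := by
          rw [← integral_map hΦ.aemeasurable hdiag.aestronglyMeasurable, hΦ.map_eq]
  have hnorm : ∫ c, ‖massVector (ρ c)‖ ^ 2 ∂μ = ∫ c, ‖massVector (tailLaw μ c)‖ ^ 2 ∂μ := by
    simp only [ρ, norm_massVector_map_mul_right]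
    rw [← integral_map hΦ.aemeasurable (hmass.norm.pow_const 2).aestronglyMeasurable, hΦ.map_eq]
  filter_upwards [ae_eq_of_integral_inner_eq (memLp_massVector (tailLaw μ).measurable)
    (memLp_massVector hρ) hinner hnorm] with c hc
  rw [massVector_inj.1 hc, map_mul_right_map_mul_right]
  simp

lemma exists_ae_tailLaw_shift_eq_map [IsProbabilityMeasure μ] (hσ : MeasurePreserving shift μ μ)
    (hΦ : Ergodic multCA μ) : ∃ η : Measure A, IsProbabilityMeasure η ∧
      ∀ᵐ a ∂μ, tailLaw μ (shift a) = η.map (· * a 0) := by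
  let ρ : (ℕ → A) → Measure A := fun a => (tailLaw μ (shift a)).map (· * (a 0)⁻¹)
  have hρ : Measurable ρ := measurable_measure_map_mul_right
    ((tailLaw μ).measurable.comp hσ.measurable) (measurable_pi_apply 0).inv
  have hprob : ∀ a, IsProbabilityMeasure (ρ a) := fun a =>
    Measure.isProbabilityMeasure_map (by fun_prop)
  have hinv : (fun a => massVector (ρ a)) ∘ multCA =ᵐ[μ] fun a => massVector (ρ a) := by
    filter_upwards [hσ.quasiMeasurePreserving.ae (tailLaw_multCA hσ hΦ.toMeasurePreserving)]
      with a ha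
    change massVector ((tailLaw μ (multCA (shift a))).map (· * (a 0 * a 1)⁻¹)) = _
    rw [ha, map_mul_right_map_mul_right, mul_inv_rev]
    simp only [ρ, shift, zero_add, mul_inv_cancel_left]
  obtain ⟨v, hv⟩ := hΦ.ae_eq_const_of_ae_eq_comp_ae
    (measurable_massVector.comp hρ).aestronglyMeasurable hinv
  obtain ⟨a₀, ha₀⟩ := hv.exists
  refine ⟨ρ a₀, hprob a₀, ?_⟩
  filter_upwards [hv] with a ha
  rw [← massVector_inj.1 (ha.trans ha₀.symm), map_mul_right_map_mul_right]
  simp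

lemma ae_map_mul_right_eq_self [IsProbabilityMeasure μ] (hσ : MeasurePreserving shift μ μ)
    {η : Measure A} [IsFiniteMeasure η] (hη : ∀ᵐ a ∂μ, tailLaw μ (shift a) = η.map (· * a 0)) :
    ∀ᵐ g ∂η, η.map (· * g) = η := by
  have hmeas : MeasurableSet {z : (ℕ → A) × A | tailLaw μ z.1 = η.map (· * z.2)} :=
    measurableSet_measure_eq ((tailLaw μ).measurable.comp measurable_fst)
      (measurable_measure_map_mul_right measurable_const measurable_snd)
  have hjoint : ∀ᵐ z ∂(μ ⊗ₘ tailLaw μ), tailLaw μ z.1 = η.map (· * z.2) := by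
    rw [compProd_tailLaw hσ, ae_map_iff
      (hσ.measurable.prodMk (measurable_pi_apply 0)).aemeasurable hmeas]
    exact hη
  obtain ⟨c, hc⟩ := (Measure.ae_ae_of_ae_compProd hjoint).exists
  obtain ⟨x, hx⟩ := hc.exists
  simp only [hx] at hc
  filter_upwards [ae_of_ae_map (f := (· * x)) (by fun_prop) hc] with g hg
  have hcancel := congrArg (Measure.map (· * x⁻¹)) hg
  simpa [map_mul_right_map_mul_right] using hcancel.symm

omit [Group A] in
lemma eq_uniformOn_of_measure_singleton_eq {s : Set A} {ν : Measure A} [IsProbabilityMeasure ν]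
    (hs : ∀ᵐ x ∂ν, x ∈ s) {m : ENNReal} (hm : ∀ x ∈ s, ν {x} = m) : ν = uniformOn s := by
  have hν : ν = m • Measure.count.restrict s := Measure.ext_of_singleton fun x => by
    by_cases hx : x ∈ s
    · simp [hm x hx, hx]
    · simpa [hx] using measure_mono_null (Set.singleton_subset_iff.2 hx) (ae_iff.1 hs)
  have hm1 : m * Measure.count s = 1 := by
    have huniv := measure_univ (μ := ν)
    rwa [hν, Measure.smul_apply, Measure.restrict_apply_univ, smul_eq_mul] at huniv
  rw [hν, uniformOn, ProbabilityTheory.cond, ENNReal.eq_inv_of_mul_eq_one_left hm1]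

open scoped Pointwise in
lemma exists_subgroup_forall_map_mul_right_eq_uniformOn {η : Measure A} [IsProbabilityMeasure η]
    (hη : ∀ᵐ g ∂η, η.map (· * g) = η) :
    ∃ C : Subgroup A, ∀ x, η.map (· * x) = uniformOn (MulOpposite.op x • (C : Set A)) := by
  let C : Subgroup A :=
    { carrier := {g | η.map (· * g) = η}
      one_mem' := by simp
      mul_mem' := fun {g h} (hg : η.map _ = η) (hh : η.map _ = η) => by
        simp only [Set.mem_ofPred_eq, ← map_mul_right_map_mul_right, hg, hh]
      inv_mem' := fun {g} (hg : η.map _ = η) => by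
        have h := congrArg (Measure.map (· * g⁻¹)) hg
        simpa [map_mul_right_map_mul_right] using h.symm }
  refine ⟨C, fun x => ?_⟩
  have := Measure.isProbabilityMeasure_map (μ := η) (f := (· * x)) (by fun_prop)
  refine eq_uniformOn_of_measure_singleton_eq (m := η {1}) ?_ ?_
  · rw [ae_map_iff (by fun_prop) .of_discrete]
    filter_upwards [hη] with g hg
    rw [mem_rightCoset_iff, mul_inv_cancel_right]
    exact hg
  · intro y hy
    have hC : η.map (· * (y * x⁻¹)) = η := (mem_rightCoset_iff x).1 hy
    have hone := map_mul_right_apply_singleton η (y * x⁻¹) (y * x⁻¹)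
    rwa [hC, mul_inv_cancel, ← map_mul_right_apply_singleton] at hone

open scoped Pointwise in
theorem exists_subgroup_ae_tailLaw_shift_eq_uniformOn [IsProbabilityMeasure μ]
    (hσ : MeasurePreserving shift μ μ) (hΦ : Ergodic multCA μ) :
    ∃ C : Subgroup A, ∀ᵐ a ∂μ,
      tailLaw μ (shift a) = uniformOn (MulOpposite.op (a 0) • (C : Set A)) := by
  obtain ⟨η, _, hη⟩ := exists_ae_tailLaw_shift_eq_map hσ hΦ
  obtain ⟨C, hC⟩ := exists_subgroup_forall_map_mul_right_eq_uniformOn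
    (ae_map_mul_right_eq_self hσ hη)
  exact ⟨C, hη.mono fun a ha => ha.trans (hC (a 0))⟩

open scoped Pointwise in
theorem entropy_shift_le_logb_card_of_tailLaw [IsProbabilityMeasure μ]
    (hσ : MeasurePreserving shift μ μ) {C : Subgroup A}
    (hC : ∀ᵐ a ∂μ, tailLaw μ (shift a) = uniformOn (MulOpposite.op (a 0) • (C : Set A))) :
    entropy shift μ ≤ ((Real.logb 2 (Nat.card C) : ℝ) : EReal) := by
  obtain ⟨κ, hκ⟩ := exists_injective_rightCoset_prodMk C
  have hsupport : Measurable fun c => {x | tailLaw μ c {x} ≠ 0} := measurable_set_iff.2 fun x =>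
    measurable_mem.2 <|
      ((tailLaw μ).measurable_coe (measurableSet_singleton x) (measurableSet_singleton 0)).compl
  refine entropy_shift_le_logb_card hσ hκ hsupport ?_
  filter_upwards [hC] with a ha
  ext x
  simp [ha, uniformOn_eq_zero_iff (Set.toFinite _)]

end Rigidity

section Bernoulli

variable {A : Type*} [MeasurableSpace A] {μ : Measure (ℕ → A)} {ν : Measure A}

lemma measure_forall_lt_mem_eq_prod [IsProbabilityMeasure μ] [SFinite ν]
    (h : μ.map (fun a => (shift a, a 0)) = μ.prod ν) (n : ℕ) {t : ℕ → Set A}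
    (ht : ∀ i, MeasurableSet (t i)) :
    μ {a | ∀ i < n, a i ∈ t i} = ∏ i ∈ Finset.range n, ν (t i) := by
  induction n generalizing t with
  | zero => simp
  | succ n ih =>
    let B : Set (ℕ → A) := {a | ∀ i < n, a i ∈ t (i + 1)}
    have hB : MeasurableSet B := by
      simp only [B, Set.ofPred_forall]
      exact .iInter fun i => .iInter fun _ => measurable_pi_apply i (ht (i + 1))
    have hshift : Measurable fun a : ℕ → A => (shift a, a 0) :=
      (measurable_pi_lambda _ fun i => measurable_pi_apply (i + 1)).prodMk (measurable_pi_apply 0)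
    have hsplit : {a | ∀ i < n + 1, a i ∈ t i} = (fun a => (shift a, a 0)) ⁻¹' (B ×ˢ t 0) := by
      ext a
      refine ⟨fun ha => ⟨fun i hi => ha (i + 1) (by lia), ha 0 n.succ_pos⟩, ?_⟩
      rintro ⟨hsucc, h0⟩ (_ | i) hi
      exacts [h0, hsucc i (by lia)]
    rw [hsplit, ← Measure.map_apply hshift (hB.prod (ht 0)), h, Measure.prod_prod,
      ih fun i => ht (i + 1), Finset.prod_range_succ']

lemma eq_infinitePi_of_map_shift_zero [IsProbabilityMeasure μ] [IsProbabilityMeasure ν]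
    (h : μ.map (fun a => (shift a, a 0)) = μ.prod ν) : μ = Measure.infinitePi fun _ => ν := by
  classical
  refine Measure.eq_infinitePi _ fun s t ht => ?_
  let t' : ℕ → Set A := fun i => if i ∈ s then t i else Set.univ
  have ht' : ∀ i, MeasurableSet (t' i) := fun i => by
    by_cases hi : i ∈ s <;> simp [t', hi, ht]
  have hlt : ∀ i ∈ s, i < s.sup id + 1 := fun i hi => Nat.lt_succ_of_le (Finset.le_sup (f := id) hi)
  have hset : Set.pi s t = {a | ∀ i < s.sup id + 1, a i ∈ t' i} := by
    ext a
    simp only [Set.mem_pi, Set.mem_ofPred_eq, t']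
    grind
  rw [hset, measure_forall_lt_mem_eq_prod h _ ht',
    ← Finset.prod_subset (fun i hi => Finset.mem_range.2 (hlt i hi)) fun i _ hi => by simp [t', hi]]
  exact Finset.prod_congr rfl fun i hi => by simp [t', hi]

lemma eq_infinitePi_of_ae_tailLaw_shift_eq [Finite A] [DiscreteMeasurableSpace A] [Nonempty A]
    [IsProbabilityMeasure μ] [IsProbabilityMeasure ν] (hσ : MeasurePreserving shift μ μ)
    (h : ∀ᵐ a ∂μ, tailLaw μ (shift a) = ν) : μ = Measure.infinitePi fun _ => ν := by
  have hmeas : MeasurableSet {c | tailLaw μ c = ν} :=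
    measurableSet_measure_eq (tailLaw μ).measurable measurable_const
  have hconst : tailLaw μ =ᵐ[μ] Kernel.const _ ν := by
    have hmap : ∀ᵐ c ∂μ.map shift, tailLaw μ c = ν := (ae_map_iff hσ.aemeasurable hmeas).2 h
    rwa [hσ.map_eq] at hmap
  refine eq_infinitePi_of_map_shift_zero ?_
  rw [← compProd_tailLaw hσ, Measure.compProd_congr hconst, Measure.compProd_const]

end Bernoulli

end MultCA

theorem mainTheorem4 {A : Type*} [Group A] [Finite A] [MeasurableSpace A]
    [DiscreteMeasurableSpace A] (μ : Measure (ℕ → A)) [IsProbabilityMeasure μ]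
    (hσ : MeasurePreserving (MultCA.shift (A := A)) μ μ)
    (hΦ : Ergodic (MultCA.multCA (A := A)) μ)
    (hent : ((MultCA.hMax A : ℝ) : EReal) < MultCA.entropy (MultCA.shift (A := A)) μ) :
    μ = MultCA.uniformMeasure A := by
  obtain ⟨C, hC⟩ := MultCA.exists_subgroup_ae_tailLaw_shift_eq_uniformOn hσ hΦ
  obtain rfl : C = ⊤ := by
    by_contra hne
    exact hent.not_ge ((MultCA.entropy_shift_le_logb_card_of_tailLaw hσ hC).trans
      (EReal.coe_le_coe_iff.2 (MultCA.logb_card_le_hMax hne)))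
  have := isProbabilityMeasure_uniformOn (Set.finite_univ (α := A)) Set.univ_nonempty
  refine MultCA.eq_infinitePi_of_ae_tailLaw_shift_eq hσ ?_
  simpa only [Subgroup.coe_top, Set.smul_set_univ] using hC
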